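/- A \emph{$d$-domain} is an open subset of $\mathbb{R}^d$. A smooth map $\pi : E \to X$ of diffeological spaces is a \emph{diffeological étale map} if for every plot $P : U \to X$ ($U$ a domain) the pullback $P^*\pi : \{(r,\xi)\in U\times E \mid P(r)=\pi(\xi)\} \to U$, $(r,\xi)\mapsto r$, is étale, i.e. around every point of its source it restricts to a diffeomorphism between D-open subsets. A diffeological space is a \emph{diffeological étale $d$-manifold} if it is covered by the images of diffeological étale maps defined on $d$-domains. The \emph{internal tangent space} $T_xX$ is the colimit of the vector spaces $T_0\,\mathrm{dom}(P)$ over the category of germs of plots $P$ in $X$ centered at $x$ (that is, $0\in\mathrm{dom}(P)$ and $P(0)=x$), a morphism $Q\to P$ being the germ at $0$ of a smooth map $F$ with $F(0)=0$ and $Q=P\circ F$ near $0$, which acts by $dF_0$. A smooth map $f : X\to Y$ induces linear maps $df_x : T_xX\to T_{f(x)}Y$, determined by $df_x\circ dP_0=d(f\circ P)_0$; it has \emph{constant internal rank} $k$ if $\operatorname{rank} df_x=k$ for every $x\in X$. \textbf{Theorem (rank theorem for diffeological étale manifolds).} Let $\mathcal{M}$ and $\mathcal{N}$ be diffeological étale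 manifolds of dimensions $m$ and $n$, respectively, and let $f:\mathcal{M}\to\mathcal{N}$ be a smooth map with constant internal rank $k$. Then for each $x\in\mathcal{M}$ we have $k\le m$ and $k\le n$, and there exist an $m$-domain $U$, an $n$-domain $V$, and diffeological étale maps $\varphi:U\to\mathcal{M}$ with $x\in\varphi(U)$ and $\psi:V\to\mathcal{N}$ with $f(x)\in\psi(V)$, such that $\widehat F(U)\subseteq V$ and $f\circ\varphi=\psi\circ\widehat F|_U$, where $\widehat F:\mathbb{R}^m\to\mathbb{R}^n$ is given by $$\widehat F(x_1,\dots,x_k,x_{k+1},\dots,x_m)=(x_1,\dots,x_k,0,\dots,0).$$ -/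

import Mathlib

open scoped ContDiff Topology

noncomputable section

namespace EtaleDiffeology

open Diffeology TopologicalSpace

/-- Euclidean space `ℝⁿ`; an `n`-domain is a term of `Opens (Eucl n)`. -/
abbrev Eucl (n : ℕ) : Type := EuclideanSpace ℝ (Fin n)

/-! ### Subspaces, products, pullbacks -/

/-- The subspace diffeology: a map into the subtype is a plot iff it is a plot in `X`. In
particular every `n`-domain `U` is a diffeological space, and a parametrization `P : U → X` is a
plot exactly when `DSmooth P`. -/
instance subtypeDiffeology {X : Type*} [DiffeologicalSpace X] (s : X → Prop) :
    DiffeologicalSpace (Subtype s) where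
  plots n := {p | IsPlot (fun r => (p r : X))}
  constant_plots x := DiffeologicalSpace.constant_plots (x : X)
  plot_reparam hp hf := DiffeologicalSpace.plot_reparam hp hf
  locality hp := DiffeologicalSpace.locality fun x =>
    let ⟨u, hu, hxu, h⟩ := hp x
    ⟨u, hu, hxu, fun hfu hf => h hfu hf⟩

/-- The product diffeology. -/
instance prodDiffeology {X Y : Type*} [DiffeologicalSpace X] [DiffeologicalSpace Y] :
    DiffeologicalSpace (X × Y) where
  plots n := {p | IsPlot (fun r => (p r).1) ∧ IsPlot (fun r => (p r).2)}
  constant_plots x :=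
    ⟨DiffeologicalSpace.constant_plots x.1, DiffeologicalSpace.constant_plots x.2⟩
  plot_reparam hp hf :=
    ⟨DiffeologicalSpace.plot_reparam hp.1 hf, DiffeologicalSpace.plot_reparam hp.2 hf⟩
  locality hp :=
    ⟨DiffeologicalSpace.locality fun x =>
      let ⟨u, hu, hxu, h⟩ := hp x
      ⟨u, hu, hxu, fun hfu hf => (h hfu hf).1⟩,
     DiffeologicalSpace.locality fun x =>
      let ⟨u, hu, hxu, h⟩ := hp x
      ⟨u, hu, hxu, fun hfu hf => (h hfu hf).2⟩⟩

/-! ### Étale maps and diffeological étale maps -/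

/-- `f` is étale: around every point it restricts to a diffeomorphism between D-open subsets. -/
def IsEtale {X Y : Type*} [DiffeologicalSpace X] [DiffeologicalSpace Y] (f : X → Y) : Prop :=
  ∀ x₀ : X, ∃ (O : Set X) (O' : Set Y), IsOpen[dTopology] O ∧ IsOpen[dTopology] O' ∧
    x₀ ∈ O ∧ f x₀ ∈ O' ∧
    ∃ e : O ≃ O', DSmooth e ∧ DSmooth e.symm ∧ ∀ x : O, (e x : Y) = f x

/-- `π` is a diffeological étale map: it is smooth and its pullback `P^*π : P^*E → U` by every
plot `P : U → X` (defined on a domain `U`) is étale. -/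
def IsDiffEtale {E X : Type*} [DiffeologicalSpace E] [DiffeologicalSpace X] (π : E → X) : Prop :=
  DSmooth π ∧ ∀ (d : ℕ) (U : Opens (Eucl d)) (P : U → X), DSmooth P →
    IsEtale (Function.Pullback.fst : Function.Pullback P π → U)

/-- `M` is a diffeological étale `n`-manifold: it has an atlas, that is, a family of
diffeological étale maps defined on `n`-domains whose images cover `M`. -/
def IsEtaleManifold (n : ℕ) (M : Type*) [DiffeologicalSpace M] : Prop :=
  ∃ A : Set (Σ U : Opens (Eucl n), (U → M)),
    (∀ c ∈ A, IsDiffEtale c.2) ∧ ∀ x : M, ∃ c ∈ A, x ∈ Set.range c.2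

/-! ### Internal tangent spaces -/

/-- A plot in `X` centered at `x`: it is defined on a domain containing `0` and sends `0` to
`x`. -/
structure CenteredPlot (X : Type*) [DiffeologicalSpace X] (x : X) where
  dim : ℕ
  dom : Opens (Eucl dim)
  zero_mem : (0 : Eucl dim) ∈ dom
  toFun : dom → X
  smooth : DSmooth toFun
  map_zero : toFun ⟨0, zero_mem⟩ = x

/-- The composition of a smooth map with a centered plot. -/
def CenteredPlot.map {X Y : Type*} [DiffeologicalSpace X] [DiffeologicalSpace Y] {f : X → Y}
    (hf : DSmooth f) {x : X} (P : CenteredPlot X x) : CenteredPlot Y (f x) where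
  dim := P.dim
  dom := P.dom
  zero_mem := P.zero_mem
  toFun := f ∘ P.toFun
  smooth := hf.comp P.smooth
  map_zero := congrArg f P.map_zero

/-- `F` represents a morphism `Q ⟶ P` of germs of centered plots: near `0` it is smooth, takes
values in the domain of `P`, and satisfies `Q = P ∘ F`; moreover `F 0 = 0`. -/
def IsGermHom {X : Type*} [DiffeologicalSpace X] {x : X} (Q P : CenteredPlot X x)
    (F : Eucl Q.dim → Eucl P.dim) : Prop :=
  F 0 = 0 ∧ ∃ W : Opens (Eucl Q.dim), (0 : Eucl Q.dim) ∈ W ∧ ContDiffOn ℝ ∞ F W ∧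
    ∀ r ∈ W, ∃ (hQ : r ∈ Q.dom) (hP : F r ∈ P.dom), Q.toFun ⟨r, hQ⟩ = P.toFun ⟨F r, hP⟩

open Classical in
/-- The relations `ι_P (dF₀ v) = ι_Q v`, for all morphisms `F : Q ⟶ P`, in the direct sum of the
tangent spaces `T₀ (dom P) = ℝ^(dim P)` over all plots centered at `x`. -/
def tangentRelations (X : Type*) [DiffeologicalSpace X] (x : X) :
    Submodule ℝ (DirectSum (CenteredPlot X x) fun P => Eucl P.dim) :=
  Submodule.span ℝ {w | ∃ (Q P : CenteredPlot X x) (F : Eucl Q.dim → Eucl P.dim) (v : Eucl Q.dim),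
    IsGermHom Q P F ∧
    w = DirectSum.lof ℝ (CenteredPlot X x) (fun P => Eucl P.dim) P (fderiv ℝ F 0 v) -
        DirectSum.lof ℝ (CenteredPlot X x) (fun P => Eucl P.dim) Q v}

/-- The internal tangent space `T_x X`: the colimit of the functor `T₀` from the category of germs
of plots centered at `x` to real vector spaces, realized as the quotient of the direct sum by the
relations given by the morphisms. -/
abbrev InternalTangentSpace (X : Type*) [DiffeologicalSpace X] (x : X) : Type _ :=
  (DirectSum (CenteredPlot X x) fun P => Eucl P.dim) ⧸ tangentRelations X x

open Classical in
/-- The structure map `dP₀ : T₀ (dom P) → T_x X` of the colimit. -/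
def plotDiff {X : Type*} [DiffeologicalSpace X] {x : X} (P : CenteredPlot X x) :
    Eucl P.dim →ₗ[ℝ] InternalTangentSpace X x :=
  (tangentRelations X x).mkQ ∘ₗ DirectSum.lof ℝ (CenteredPlot X x) (fun P => Eucl P.dim) P

theorem plotDiff_fderiv {X : Type*} [DiffeologicalSpace X] {x : X} {Q P : CenteredPlot X x}
    {F : Eucl Q.dim → Eucl P.dim} (hF : IsGermHom Q P F) (v : Eucl Q.dim) :
    plotDiff P (fderiv ℝ F 0 v) = plotDiff Q v :=
  (Submodule.Quotient.eq _).2 (Submodule.subset_span ⟨Q, P, F, v, hF, rfl⟩)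

open Classical in
/-- The map out of the colimit `T_x X` induced by a cocone. -/
def tangentDesc {X : Type*} [DiffeologicalSpace X] {x : X} {V : Type*} [AddCommGroup V]
    [Module ℝ V] (c : ∀ P : CenteredPlot X x, Eucl P.dim →ₗ[ℝ] V)
    (hc : ∀ (Q P : CenteredPlot X x) (F : Eucl Q.dim → Eucl P.dim), IsGermHom Q P F →
      ∀ v, c P (fderiv ℝ F 0 v) = c Q v) :
    InternalTangentSpace X x →ₗ[ℝ] V :=
  (tangentRelations X x).liftQ (DirectSum.toModule ℝ (CenteredPlot X x) V c) <| by
    refine Submodule.span_le.2 ?_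
    rintro _ ⟨Q, P, F, v, hF, rfl⟩
    simp [DirectSum.toModule_lof, hc Q P F hF v]

theorem tangentDesc_plotDiff {X : Type*} [DiffeologicalSpace X] {x : X} {V : Type*}
    [AddCommGroup V] [Module ℝ V] (c : ∀ P : CenteredPlot X x, Eucl P.dim →ₗ[ℝ] V)
    (hc : ∀ (Q P : CenteredPlot X x) (F : Eucl Q.dim → Eucl P.dim), IsGermHom Q P F →
      ∀ v, c P (fderiv ℝ F 0 v) = c Q v) (P : CenteredPlot X x) (v : Eucl P.dim) :
    tangentDesc c hc (plotDiff P v) = c P v := by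
  classical
  exact DirectSum.toModule_lof ℝ (φ := c) P v

theorem tangent_hom_ext {X : Type*} [DiffeologicalSpace X] {x : X} {V : Type*}
    [AddCommGroup V] [Module ℝ V] {a b : InternalTangentSpace X x →ₗ[ℝ] V}
    (h : ∀ (P : CenteredPlot X x) (v : Eucl P.dim), a (plotDiff P v) = b (plotDiff P v)) :
    a = b := by
  classical
  refine Submodule.linearMap_qext _ (DirectSum.linearMap_ext ℝ fun P => LinearMap.ext fun v => ?_)
  exact h P v

theorem IsGermHom.map {X Y : Type*} [DiffeologicalSpace X] [DiffeologicalSpace Y] {f : X → Y}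
    (hf : DSmooth f) {x : X} {Q P : CenteredPlot X x} {F : Eucl Q.dim → Eucl P.dim}
    (h : IsGermHom Q P F) : IsGermHom (Q.map hf) (P.map hf) F := by
  obtain ⟨h0, W, hW, hF, hr⟩ := h
  refine ⟨h0, W, hW, hF, fun r hrW => ?_⟩
  obtain ⟨hQ, hP, e⟩ := hr r hrW
  exact ⟨hQ, hP, congrArg f e⟩

/-- The internal tangent map `df_x : T_x X → T_{f(x)} Y`, the unique linear map with
`df_x ∘ dP₀ = d(f ∘ P)₀` for all plots `P` centered at `x`. -/
def tangentMap {X Y : Type*} [DiffeologicalSpace X] [DiffeologicalSpace Y] {f : X → Y}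
    (hf : DSmooth f) (x : X) :
    InternalTangentSpace X x →ₗ[ℝ] InternalTangentSpace Y (f x) :=
  tangentDesc (fun P => plotDiff (P.map hf)) fun _ _ _ hF v => plotDiff_fderiv (hF.map hf) v

theorem tangentMap_plotDiff {X Y : Type*} [DiffeologicalSpace X] [DiffeologicalSpace Y]
    {f : X → Y} (hf : DSmooth f) {x : X} (P : CenteredPlot X x) (v : Eucl P.dim) :
    tangentMap hf x (plotDiff P v) = plotDiff (P.map hf) v :=
  tangentDesc_plotDiff _ _ P v

/-- The smooth map `f` has constant internal rank `k`. -/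
def HasConstantInternalRank {X Y : Type*} [DiffeologicalSpace X] [DiffeologicalSpace Y]
    {f : X → Y} (hf : DSmooth f) (k : ℕ) : Prop :=
  ∀ x : X, (tangentMap hf x).rank = (k : Cardinal)

/-! ### The normal form -/

/-- The map `(x₁, …, x_k, x_{k+1}, …, x_m) ↦ (x₁, …, x_k, 0, …, 0)` from `ℝᵐ` to `ℝⁿ`. -/
def rankNormalForm (m n k : ℕ) (hkm : k ≤ m) (x : Eucl m) : Eucl n :=
  WithLp.toLp 2 fun i : Fin n => if h : i.1 < k then x ⟨i.1, h.trans_le hkm⟩ else 0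

end EtaleDiffeology

end

/-!
The proof reduces to the constant rank theorem for maps between domains of `ℝᵐ` and `ℝⁿ`. Plots lift
along a diffeological étale map `π`, locally and uniquely through a prescribed point, so lifting
centered plots inverts the tangent maps of `π`, which are therefore isomorphisms. Lifting `f ∘ φ`
along a chart `ψ` gives a smooth map `F` between domains with `f ∘ φ = ψ ∘ F`, and the internal rank
of `f` at `φ u` is the rank of the derivative of `F` at `u`. If it is constant, then `F` is the
normal form up to diffeomorphisms between open sets, which are absorbed into the charts.

For the constant rank theorem itself, let `B` be a generalized inverse of the derivative `A` of `F`
at a point. A change of coordinates in the source turns `B ∘ F` into `B ∘ A`, so constancy of the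
rank makes the kernel of every nearby derivative equal to `ker A`. Hence `F` factors through `B ∘ F`
near the point, and a shear of the target removes the component of `F` outside the range of `A`.
-/

namespace EtaleDiffeology

open Diffeology TopologicalSpace

/-! ### The constant rank theorem -/

section LinearAlgebra

variable {K V W : Type*} [Field K] [AddCommGroup V] [Module K V] [FiniteDimensional K V]
  [AddCommGroup W] [Module K W]

theorem ker_eq_of_comp_eq_comp {A T : V →ₗ[K] W} {B : W →ₗ[K] V}
    (hA : A ∘ₗ B ∘ₗ A = A) (hT : B ∘ₗ T = B ∘ₗ A)
    (hrank : Module.finrank K T.range = Module.finrank K A.range) : T.ker = A.ker := by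
  have hle : T.ker ≤ A.ker := by
    rw [← hA, ← hT]
    exact (LinearMap.ker_le_ker_comp T B).trans (LinearMap.ker_le_ker_comp (B ∘ₗ T) A)
  have hT_dim := T.finrank_range_add_finrank_ker
  have hA_dim := A.finrank_range_add_finrank_ker
  exact Submodule.eq_of_le_of_finrank_eq hle (by omega)

theorem exists_linearEquiv_comp_eq_comp {A A' : V →ₗ[K] W}
    (h : Module.finrank K A.range = Module.finrank K A'.range) :
    ∃ (a : V ≃ₗ[K] V) (b : W ≃ₗ[K] W), ∀ v, b (A v) = A' (a v) := by
  have hker : Module.finrank K A.ker = Module.finrank K A'.ker := by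
    have hA_dim := A.finrank_range_add_finrank_ker
    have hA'_dim := A'.finrank_range_add_finrank_ker
    omega
  let e := LinearEquiv.ofFinrankEq A.range A'.range h
  let κ := LinearEquiv.ofFinrankEq A.ker A'.ker hker
  obtain ⟨b, hb⟩ := Submodule.exists_linearEquiv_restrict_eq e
  obtain ⟨s, hs⟩ := A'.rangeRestrict.exists_rightInverse_of_surjective A'.range_rangeRestrict
  obtain ⟨r, hr⟩ := A.ker.subtype.exists_leftInverse_of_injective A.ker.ker_subtype
  let a : V →ₗ[K] V := s ∘ₗ e.toLinearMap ∘ₗ A.rangeRestrict + A'.ker.subtype ∘ₗ κ.toLinearMap ∘ₗ r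
  have ha (v : V) : A' (a v) = b (A v) := by
    have hsv := congrArg Subtype.val (LinearMap.congr_fun hs (e (A.rangeRestrict v)))
    have hκv : A' (κ (r v)) = 0 := (κ (r v)).2
    simpa [a, hκv] using hsv.trans (hb (A.rangeRestrict v))
  have ha_inj : Function.Injective a := by
    refine (injective_iff_map_eq_zero a).2 fun v hv => ?_
    have hAv : A v = 0 := by simpa [hv] using (ha v).symm
    have hrv : r v = ⟨v, hAv⟩ := LinearMap.congr_fun hr ⟨v, hAv⟩
    have hAv' : A.rangeRestrict v = 0 := Subtype.ext hAv
    have hκv : κ ⟨v, hAv⟩ = 0 := by simpa [a, hAv', hrv] using hv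
    exact congrArg Subtype.val (κ.map_eq_zero_iff.1 hκv)
  exact ⟨LinearEquiv.ofInjectiveEndo a ha_inj, b, fun v => (ha v).symm⟩

end LinearAlgebra

section Calculus

variable {E E' F : Type*} [NormedAddCommGroup E] [NormedSpace ℝ E]
  [NormedAddCommGroup F] [NormedSpace ℝ F] [NormedAddCommGroup E'] [NormedSpace ℝ E']

theorem exists_generalizedInverse [FiniteDimensional ℝ E] (A : E →L[ℝ] F) :
    ∃ B : F →L[ℝ] E, A ∘L B ∘L A = A ∧ B ∘L A ∘L B = B := by
  obtain ⟨P, hP⟩ := Submodule.ClosedComplemented.of_finiteDimensional A.range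
  let A₁ : E →L[ℝ] A.range := A.codRestrict A.range fun v => ⟨v, rfl⟩
  obtain ⟨s, hs⟩ := A₁.exists_rightInverse_of_surjective
    (LinearMap.range_eq_top.2 fun ⟨_, v, hv⟩ => ⟨v, Subtype.ext hv⟩)
  have hAs (w : A.range) : A (s w) = w := congrArg Subtype.val (DFunLike.congr_fun hs w)
  refine ⟨s ∘L P, ?_, ?_⟩ <;> ext v
  · have hPv : P (A v) = A₁ v := hP (A₁ v)
    exact (congrArg (fun w => A (s w)) hPv).trans (hAs _)
  · simp [hAs, hP]

theorem eq_of_fderiv_sub_eq_zero {f : E → F} {s : Set E} (hs : Convex ℝ s)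
    (hf : ∀ z ∈ s, DifferentiableAt ℝ f z) {x y : E} (hx : x ∈ s) (hy : y ∈ s)
    (h : ∀ z ∈ s, fderiv ℝ f z (y - x) = 0) : f y = f x := by
  have hderiv (t : ℝ) (ht : t ∈ Set.Icc (0 : ℝ) 1) :
      HasDerivAt (fun t => f (AffineMap.lineMap x y t)) 0 t := by
    have hz := hs.lineMap_mem hx hy ht
    rw [← h _ hz]
    exact (hf _ hz).hasFDerivAt.comp_hasDerivAt t AffineMap.hasDerivAt_lineMap
  have := constant_of_has_deriv_right_zero
    (fun t ht => (hderiv t ht).continuousAt.continuousWithinAt)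
    (fun t ht => (hderiv t (Set.Ico_subset_Icc_self ht)).hasDerivWithinAt) 1
    (Set.right_mem_Icc.2 zero_le_one)
  simpa using this

/-- A diffeomorphism of class `C^n` between open subsets of normed spaces. -/
structure IsPartialDiffeo (n : ℕ∞ω) (α : OpenPartialHomeomorph E F) : Prop where
  contDiffOn : ContDiffOn ℝ n α α.source
  contDiffOn_symm : ContDiffOn ℝ n α.symm α.target

namespace IsPartialDiffeo

variable {n : ℕ∞ω} {α : OpenPartialHomeomorph E F}

theorem trans (hα : IsPartialDiffeo n α) {β : OpenPartialHomeomorph F E'}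
    (hβ : IsPartialDiffeo n β) : IsPartialDiffeo n (α.trans β) where
  contDiffOn := by
    rw [α.coe_trans, α.trans_source]
    exact hβ.contDiffOn.comp (hα.contDiffOn.mono Set.inter_subset_left) fun _ hx => hx.2
  contDiffOn_symm := by
    rw [α.coe_trans_symm, α.trans_target]
    exact hα.contDiffOn_symm.comp (hβ.contDiffOn_symm.mono Set.inter_subset_left) fun _ hx => hx.2

theorem ofSet {s : Set E} (hs : IsOpen s) :
    IsPartialDiffeo n (OpenPartialHomeomorph.ofSet s hs) :=
  ⟨contDiffOn_id, contDiffOn_id⟩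

theorem transContinuousLinearEquiv (hα : IsPartialDiffeo n α) (a : F ≃L[ℝ] E') :
    IsPartialDiffeo n (α.transHomeomorph a.toHomeomorph) where
  contDiffOn := a.contDiff.comp_contDiffOn hα.contDiffOn
  contDiffOn_symm := hα.contDiffOn_symm.comp a.symm.contDiff.contDiffOn fun _ => id

theorem range_fderiv_comp_symm (hα : IsPartialDiffeo n α) (hn : n ≠ 0) {f : E → E'} {y : F}
    (hy : y ∈ α.target) (hf : DifferentiableAt ℝ f (α.symm y)) :
    (fderiv ℝ (f ∘ α.symm) y).range = (fderiv ℝ f (α.symm y)).range := by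
  have hsymm : DifferentiableAt ℝ α.symm y :=
    (hα.contDiffOn_symm.contDiffAt (α.open_target.mem_nhds hy)).differentiableAt hn
  have hα' : DifferentiableAt ℝ α (α.symm y) :=
    (hα.contDiffOn.contDiffAt (α.open_source.mem_nhds (α.map_target hy))).differentiableAt hn
  have hsurj : Function.Surjective (fderiv ℝ α.symm y) := fun v => by
    refine ⟨fderiv ℝ α (α.symm y) v, ?_⟩
    have hid : HasFDerivAt (α.symm ∘ α) (ContinuousLinearMap.id ℝ E) (α.symm y) :=
      (hasFDerivAt_id _).congr_of_eventuallyEq (α.eventually_left_inverse' hy)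
    have hsymm' : HasFDerivAt α.symm (fderiv ℝ α.symm y) (α (α.symm y)) := by
      rw [α.right_inv hy]
      exact hsymm.hasFDerivAt
    exact DFunLike.congr_fun ((hsymm'.comp _ hα'.hasFDerivAt).unique hid) v
  rw [fderiv_comp y hf hsymm]
  exact LinearMap.range_comp_of_range_eq_top _ (LinearMap.range_eq_top.2 hsurj)

end IsPartialDiffeo

theorem exists_isPartialDiffeo_of_hasFDerivAt [CompleteSpace E] {n : ℕ∞ω} (hn : n ≠ 0)
    {G : E → F} {O : Set E} (hO : IsOpen O) (hG : ContDiffOn ℝ n G O) {x : E} (hx : x ∈ O)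
    {G' : E ≃L[ℝ] F} (hG' : HasFDerivAt G (G' : E →L[ℝ] F) x) :
    ∃ α : OpenPartialHomeomorph E F, IsPartialDiffeo n α ∧ x ∈ α.source ∧ α.source ⊆ O ∧
      ⇑α = G := by
  have hGat {y : E} (hy : y ∈ O) : ContDiffAt ℝ n G y := hG.contDiffAt (hO.mem_nhds hy)
  have hinv : ∀ᶠ y in 𝓝 x, fderiv ℝ G y ∈ Set.range ((↑) : (E ≃L[ℝ] F) → E →L[ℝ] F) := by
    have hcont : ContinuousAt (fderiv ℝ G) x :=
      ((hGat hx).fderiv_right (m := 0)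
        (by simpa [ENat.one_le_iff_ne_zero_withTop] using hn)).continuousAt
    exact hcont (hG'.fderiv ▸ ContinuousLinearEquiv.nhds G')
  obtain ⟨T, hT, hT_open, hxT⟩ := eventually_nhds_iff.1 hinv
  let α := ((hGat hx).toOpenPartialHomeomorph G hG' hn).restrOpen (O ∩ T) (hO.inter hT_open)
  have hα {y : E} (hy : y ∈ α.source) : y ∈ O ∩ T := hy.2
  refine ⟨α, ⟨hG.mono fun y hy => (hα hy).1, fun z hz => ?_⟩,
    ⟨(hGat hx).mem_toOpenPartialHomeomorph_source hG' hn, hx, hxT⟩, fun y hy => (hα hy).1, rfl⟩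
  have hy := hα (α.map_target hz)
  obtain ⟨Gy', hGy'⟩ := hT _ hy.2
  have hderiv : HasFDerivAt G (Gy' : E →L[ℝ] F) (α.symm z) :=
    hGy' ▸ ((hGat hy.1).differentiableAt hn).hasFDerivAt
  exact (α.contDiffAt_symm hz hderiv (hGat hy.1)).contDiffWithinAt

/-- The shear `z ↦ z - w (p z)` of `p ⁻¹ D` along the fibres of `p`, for a map `w` with values in
`ker p`. -/
def shear (p : F →L[ℝ] E) (w : E → F) (hw : ∀ y, p (w y) = 0) {D : Set E} (hD : IsOpen D)
    (hwD : ContinuousOn w D) : OpenPartialHomeomorph F F where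
  toFun z := z - w (p z)
  invFun z := z + w (p z)
  source := p ⁻¹' D
  target := p ⁻¹' D
  map_source' z hz := by simpa [hw] using hz
  map_target' z hz := by simpa [hw] using hz
  left_inv' z _ := by simp [hw]
  right_inv' z _ := by simp [hw]
  open_source := hD.preimage p.continuous
  open_target := hD.preimage p.continuous
  continuousOn_toFun := continuousOn_id.sub (hwD.comp p.continuous.continuousOn fun _ hz => hz)
  continuousOn_invFun := continuousOn_id.add (hwD.comp p.continuous.continuousOn fun _ hz => hz)

theorem isPartialDiffeo_shear {n : ℕ∞ω} {p : F →L[ℝ] E} {w : E → F} (hw : ∀ y, p (w y) = 0)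
    {D : Set E} (hD : IsOpen D) (hwD : ContDiffOn ℝ n w D) :
    IsPartialDiffeo n (shear p w hw hD hwD.continuousOn) :=
  ⟨contDiffOn_id.sub (hwD.comp p.contDiff.contDiffOn fun _ hz => hz),
    contDiffOn_id.add (hwD.comp p.contDiff.contDiffOn fun _ hz => hz)⟩

section ConstantRank

variable {n : ℕ∞ω} {f : E → F} {O : Set E} {x₀ : E} {A : E →L[ℝ] F} {B : F →L[ℝ] E}

theorem exists_isPartialDiffeo_straightening [CompleteSpace E] (hn : n ≠ 0) (hO : IsOpen O)
    (hf : ContDiffOn ℝ n f O) (hx₀ : x₀ ∈ O) (hA : HasFDerivAt f A x₀)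
    (hBAB : B ∘L A ∘L B = B) :
    ∃ γ : OpenPartialHomeomorph E E, IsPartialDiffeo n γ ∧ x₀ ∈ γ.source ∧ γ.source ⊆ O ∧
      B (A (γ x₀)) = γ x₀ ∧ ∀ x, B (A (γ x)) = B (f x) := by
  have hBAB' (w : F) : B (A (B w)) = B w := DFunLike.congr_fun hBAB w
  -- The components of `G` along the range and the kernel of the projection `B ∘ A` are `B ∘ f` and
  -- the kernel component of `x - x₀`.
  let G (x : E) : E := B (f x) + ((x - x₀) - B (A (x - x₀)))
  have hG : ContDiffOn ℝ n G O := by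
    have hBf : ContDiffOn ℝ n (fun x => B (f x)) O := B.contDiff.comp_contDiffOn hf
    have hid : ContDiff ℝ n fun x => x - x₀ := contDiff_id.sub contDiff_const
    exact hBf.add (hid.sub ((B ∘L A).contDiff.comp hid)).contDiffOn
  have hG' : HasFDerivAt G (ContinuousLinearEquiv.refl ℝ E : E →L[ℝ] E) x₀ := by
    have hid : HasFDerivAt (fun x => x - x₀) (ContinuousLinearMap.id ℝ E) x₀ :=
      (hasFDerivAt_id x₀).sub_const x₀
    refine ((B.hasFDerivAt.comp x₀ hA).add
      (hid.sub ((B ∘L A).hasFDerivAt.comp x₀ hid))).congr_fderiv ?_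
    ext v
    simp
  obtain ⟨γ, hγ, hx₀γ, hγO, hγG⟩ := exists_isPartialDiffeo_of_hasFDerivAt hn hO hG hx₀ hG'
  refine ⟨γ, hγ, hx₀γ, hγO, ?_, fun x => ?_⟩ <;> simp [hγG, G, hBAB']

theorem eq_of_constantRank_of_sub_mem_ker [FiniteDimensional ℝ E] {H : E → F} {D : Set E}
    (hD : IsOpen D) (hD' : Convex ℝ D) (hH : DifferentiableOn ℝ H D)
    (hrank : ∀ y ∈ D, Module.finrank ℝ (fderiv ℝ H y).range = Module.finrank ℝ A.range)
    (hABA : A ∘L B ∘L A = A) (hBH : ∀ y ∈ D, B (H y) = B (A y)) {y y' : E} (hy : y ∈ D)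
    (hy' : y' ∈ D) (hyy' : y' - y ∈ A.ker) : H y' = H y := by
  have hHat (z : E) (hz : z ∈ D) : DifferentiableAt ℝ H z := hH.differentiableAt (hD.mem_nhds hz)
  refine eq_of_fderiv_sub_eq_zero hD' hHat hy hy' fun z hz => ?_
  have hBH' : B ∘L fderiv ℝ H z = B ∘L A :=
    ((B.hasFDerivAt.comp z (hHat z hz).hasFDerivAt).congr_of_eventuallyEq
      (Filter.eventually_of_mem (hD.mem_nhds hz) fun y hy => (hBH y hy).symm)).unique
      (B ∘L A).hasFDerivAt
  have hker : (fderiv ℝ H z).ker = A.ker :=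
    ker_eq_of_comp_eq_comp (B := B.toLinearMap) (congrArg ContinuousLinearMap.toLinearMap hABA)
      (congrArg ContinuousLinearMap.toLinearMap hBH') (hrank z hz)
  exact hker.ge hyy'

theorem exists_isPartialDiffeo_eq_comp [FiniteDimensional ℝ E] (hn : n ≠ 0)
    (hO : IsOpen O) (hf : ContDiffOn ℝ n f O) (hx₀ : x₀ ∈ O) (hA : HasFDerivAt f A x₀)
    (hrank : ∀ x ∈ O, Module.finrank ℝ (fderiv ℝ f x).range = Module.finrank ℝ A.range)
    (hABA : A ∘L B ∘L A = A) (hBAB : B ∘L A ∘L B = B) :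
    ∃ (α : OpenPartialHomeomorph E E) (D : Set E) (h : E → F),
      IsPartialDiffeo n α ∧ x₀ ∈ α.source ∧ α.source ⊆ O ∧ IsOpen D ∧ ContDiffOn ℝ n h D ∧
      ∀ x ∈ α.source, B (A (α x)) = B (f x) ∧ B (f x) ∈ D ∧ h (B (f x)) = f x := by
  obtain ⟨γ, hγ, hx₀γ, hγO, hγx₀, hBAγ⟩ :=
    exists_isPartialDiffeo_straightening hn hO hf hx₀ hA hBAB
  obtain ⟨ε, hε, hball⟩ := Metric.isOpen_iff.1 γ.open_target (γ x₀) (γ.map_source hx₀γ)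
  set D := Metric.ball (γ x₀) ε
  have hγx₀D : γ x₀ ∈ D := Metric.mem_ball_self hε
  have hH : ContDiffOn ℝ n (f ∘ γ.symm) D := hf.comp (hγ.contDiffOn_symm.mono hball)
    fun y hy => hγO (γ.map_target (hball hy))
  have hBH (y : E) (hy : y ∈ D) : B ((f ∘ γ.symm) y) = B (A y) := by
    rw [Function.comp_apply, ← hBAγ, γ.right_inv (hball hy)]
  have hHrank (y : E) (hy : y ∈ D) :
      Module.finrank ℝ (fderiv ℝ (f ∘ γ.symm) y).range = Module.finrank ℝ A.range := by
    have hx := hγO (γ.map_target (hball hy))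
    rw [hγ.range_fderiv_comp_symm hn (hball hy)
      ((hf.contDiffAt (hO.mem_nhds hx)).differentiableAt hn), hrank _ hx]
  have hD' : IsOpen (D ∩ (B ∘L A) ⁻¹' D) :=
    Metric.isOpen_ball.inter (Metric.isOpen_ball.preimage (B ∘L A).continuous)
  refine ⟨γ.trans (.ofSet _ hD'), D, f ∘ γ.symm, hγ.trans (.ofSet _),
    ⟨hx₀γ, hγx₀D, by simpa [hγx₀] using hγx₀D⟩, fun x hx => hγO hx.1, Metric.isOpen_ball, hH,
    fun x ⟨hxγ, hγxD, (hBAγxD : B (A (γ x)) ∈ D)⟩ => ⟨hBAγ x, hBAγ x ▸ hBAγxD, ?_⟩⟩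
  have hker : B (A (γ x)) - γ x ∈ A.ker := by
    simp [show A (B (A _)) = A _ from DFunLike.congr_fun hABA _]
  simpa [γ.left_inv hxγ, hBAγ] using eq_of_constantRank_of_sub_mem_ker Metric.isOpen_ball
    (convex_ball _ _) (hH.differentiableOn hn) hHrank hABA hBH hγxD hBAγxD hker

theorem exists_isPartialDiffeo_comp_eq_fderiv_comp [FiniteDimensional ℝ E] (hn : n ≠ 0)
    (hO : IsOpen O) (hf : ContDiffOn ℝ n f O) (hx₀ : x₀ ∈ O)
    (hrank : ∀ x ∈ O, Module.finrank ℝ (fderiv ℝ f x).range =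
      Module.finrank ℝ (fderiv ℝ f x₀).range) :
    ∃ (α : OpenPartialHomeomorph E E) (β : OpenPartialHomeomorph F F),
      IsPartialDiffeo n α ∧ IsPartialDiffeo n β ∧ x₀ ∈ α.source ∧ α.source ⊆ O ∧
      Set.MapsTo f α.source β.source ∧ ∀ x ∈ α.source, β (f x) = fderiv ℝ f x₀ (α x) := by
  have hA : HasFDerivAt f (fderiv ℝ f x₀) x₀ :=
    ((hf.contDiffAt (hO.mem_nhds hx₀)).differentiableAt hn).hasFDerivAt
  set A := fderiv ℝ f x₀
  obtain ⟨B, hABA, hBAB⟩ := exists_generalizedInverse A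
  obtain ⟨α, D, h, hα, hx₀α, hαO, hD, hh, hαf⟩ :=
    exists_isPartialDiffeo_eq_comp hn hO hf hx₀ hA hrank hABA hBAB
  let w (y : E) : F := h y - A (B (h y))
  have hw (y : E) : B (w y) = 0 := by
    simp [w, show B (A (B _)) = B _ from DFunLike.congr_fun hBAB _]
  have hwD : ContDiffOn ℝ n w D := hh.sub ((A ∘L B).contDiff.comp_contDiffOn hh)
  refine ⟨α, shear B w hw hD hwD.continuousOn, hα, isPartialDiffeo_shear hw hD hwD, hx₀α, hαO,
    fun x hx => (hαf x hx).2.1, fun x hx => ?_⟩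
  obtain ⟨hBAα, -, hfx⟩ := hαf x hx
  calc f x - w (B (f x)) = A (B (f x)) := by simp [w, hfx]
    _ = A (B (A (α x))) := by rw [hBAα]
    _ = A (α x) := DFunLike.congr_fun hABA _

end ConstantRank

end Calculus

/-! ### Domains -/

section Domains

variable {d n : ℕ} {O : Opens (Eucl d)}

theorem exists_contDiff_openPartialHomeomorph_univ {r : Eucl d} (hr : r ∈ O) :
    ∃ u : OpenPartialHomeomorph (Eucl d) (Eucl d), u.source = Set.univ ∧ r ∈ u.target ∧
      (∀ x, u x ∈ O) ∧ ContDiff ℝ ∞ u ∧ ContDiffOn ℝ ∞ u.symm u.target := by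
  obtain ⟨ε, hε, hball⟩ := Metric.isOpen_iff.mp O.isOpen r hr
  have htarget := OpenPartialHomeomorph.univBall_target r hε
  have hsource := OpenPartialHomeomorph.univBall_source r ε
  exact ⟨.univBall r ε, hsource, htarget ▸ Metric.mem_ball_self hε,
    fun x => hball (htarget ▸ OpenPartialHomeomorph.map_source _ (hsource ▸ Set.mem_univ x)),
    OpenPartialHomeomorph.contDiff_univBall,
    htarget ▸ OpenPartialHomeomorph.contDiffOn_univBall_symm⟩

theorem dTopology_opens : (dTopology : TopologicalSpace O) = instTopologicalSpaceSubtype := by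
  refine TopologicalSpace.ext_iff.2 fun s => ⟨fun hs => ?_, fun hs => ?_⟩
  · rw [O.isOpen.isOpenEmbedding_subtypeVal.isOpen_iff_image_isOpen, isOpen_iff_forall_mem_open]
    rintro _ ⟨r, hr, rfl⟩
    obtain ⟨u, husource, hru, huO, hu, -⟩ := exists_contDiff_openPartialHomeomorph_univ r.2
    let p (x : Eucl d) : O := ⟨u x, huO x⟩
    have hp : IsPlot p := hu.isPlot
    have hpr : p (u.symm r) = r := Subtype.ext (u.right_inv hru)
    refine ⟨u '' (p ⁻¹' s), ?_, u.isOpen_image_of_subset_source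
      (isOpen_iff_preimages_plots.1 hs d p hp) (husource ▸ Set.subset_univ _),
      u.symm r, by simpa [hpr] using hr, u.right_inv hru⟩
    rintro _ ⟨x, hx, rfl⟩
    exact ⟨p x, hx, rfl⟩
  · refine isOpen_iff_preimages_plots.2 fun k p hp => hs.preimage ?_
    exact (IsPlot.contDiff (p := fun r => (p r : Eucl d)) hp).continuous.subtype_mk _

theorem dSmooth_restrict {F : Eucl d → Eucl n} (hF : ContDiffOn ℝ ∞ F O) :
    DSmooth fun r : O => F r := fun _ _ hp =>
  (hF.comp_contDiff (IsPlot.contDiff hp) fun _ => Subtype.prop _).isPlot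

/-- The extension by zero of a map defined on a domain. -/
noncomputable def zeroExtend (L : O → Eucl n) : Eucl d → Eucl n :=
  Function.extend Subtype.val L 0

@[simp]
theorem zeroExtend_coe (L : O → Eucl n) (r : O) : zeroExtend L r = L r :=
  Subtype.val_injective.extend_apply L 0 r

theorem contDiffOn_zeroExtend {L : O → Eucl n} (hL : DSmooth L) :
    ContDiffOn ℝ ∞ (zeroExtend L) O := fun r hr => by
  obtain ⟨u, -, hru, huO, hu, husymm⟩ := exists_contDiff_openPartialHomeomorph_univ hr
  let p (x : Eucl d) : O := ⟨u x, huO x⟩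
  have hLp : ContDiff ℝ ∞ (L ∘ p) := (hL d p hu.isPlot).contDiff
  have hLu : ContDiffOn ℝ ∞ (zeroExtend L) u.target :=
    (hLp.comp_contDiffOn husymm).congr fun x hx => by
      have hpx : p (u.symm x) = ⟨x, u.right_inv hx ▸ huO _⟩ := Subtype.ext (u.right_inv hx)
      simp only [Function.comp_apply, hpx]
      exact zeroExtend_coe L ⟨x, _⟩
  exact (hLu.contDiffAt (u.open_target.mem_nhds hru)).contDiffWithinAt

theorem isOpen_setOf_exists_mem {s : Set O} (hs : IsOpen[dTopology] s) :
    IsOpen {x | ∃ hx : x ∈ O, (⟨x, hx⟩ : O) ∈ s} := by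
  rw [dTopology_opens] at hs
  convert O.isOpen.isOpenEmbedding_subtypeVal.isOpenMap s hs using 1
  ext x
  simp

end Domains

section Etale

variable {E X Y : Type*} [DiffeologicalSpace E] [DiffeologicalSpace X] [DiffeologicalSpace Y]
  {π : E → X}

/-- Plots of the base lift locally along `π`, through every point over a value of the plot. -/
def HasLocalLifts (π : E → X) : Prop :=
  ∀ (d : ℕ) (U : Opens (Eucl d)) (P : U → X), DSmooth P → ∀ (r : U) (e : E), P r = π e →
    ∃ (O : Opens (Eucl d)) (hOU : ∀ x ∈ O, x ∈ U) (hr : r.1 ∈ O) (L : O → E), DSmooth L ∧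
      L ⟨r, hr⟩ = e ∧ ∀ s : O, π (L s) = P ⟨s, hOU s s.2⟩

/-- Two smooth lifts of the same plot agree on an open set. -/
def HasUniqueLocalLifts (π : E → X) : Prop :=
  ∀ (d : ℕ) (O : Opens (Eucl d)) (L L' : O → E), DSmooth L → DSmooth L' → π ∘ L = π ∘ L' →
    IsOpen {r | L r = L' r}

theorem IsDiffEtale.hasLocalLifts (hπ : IsDiffEtale π) : HasLocalLifts π := by
  intro d U P hP r e hre
  obtain ⟨S, S', -, hS', hS, hrS', σ, -, hσ, hfst⟩ := hπ.2 d U P hP ⟨(r, e), hre⟩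
  let O : Opens (Eucl d) := ⟨_, isOpen_setOf_exists_mem hS'⟩
  let ι (s : O) : S' := ⟨⟨s, s.2.1⟩, s.2.2⟩
  have hι : DSmooth ι := fun _ _ hp => hp
  have hfst' (s : O) : (σ.symm (ι s)).1.1.1 = (ι s).1 :=
    (hfst _).symm.trans (congrArg Subtype.val (σ.apply_symm_apply (ι s)))
  refine ⟨O, fun x hx => hx.1, ⟨r.2, hrS'⟩, fun s => (σ.symm (ι s)).1.1.2,
    fun n p hp => ((hσ.comp hι) n p hp).2, ?_, fun s => ?_⟩
  · have hσr : σ ⟨⟨(r, e), hre⟩, hS⟩ = ι ⟨r, r.2, hrS'⟩ := Subtype.ext (hfst _)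
    exact congrArg (fun z : S => z.1.1.2) (σ.symm_apply_eq.2 hσr.symm)
  · rw [← (σ.symm (ι s)).1.2, hfst' s]

theorem IsDiffEtale.hasUniqueLocalLifts (hπ : IsDiffEtale π) : HasUniqueLocalLifts π := by
  intro d O L L' hL hL' hLL'
  let P : O → X := π ∘ L
  let σ (r : O) : Function.Pullback P π := ⟨(r, L r), rfl⟩
  let σ' (r : O) : Function.Pullback P π := ⟨(r, L' r), congrFun hLL' r⟩
  have hσ : DSmooth σ := fun n p hp => ⟨hp, hL n p hp⟩
  have hσ' : DSmooth σ' := fun n p hp => ⟨hp, hL' n p hp⟩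
  rw [isOpen_iff_forall_mem_open]
  intro r (hr : L r = L' r)
  obtain ⟨S, S', hS, -, hrS, -, e, -, -, hfst⟩ := hπ.2 d O P (hπ.1.comp hL) (σ r)
  have hrσ : σ' r = σ r := Subtype.ext (Prod.ext rfl hr.symm)
  have hopen : IsOpen[dTopology] (σ ⁻¹' S ∩ σ' ⁻¹' S) := by
    let _ : TopologicalSpace O := dTopology
    let _ : TopologicalSpace (Function.Pullback P π) := dTopology
    exact (hS.preimage hσ.continuous).inter (hS.preimage hσ'.continuous)
  refine ⟨σ ⁻¹' S ∩ σ' ⁻¹' S, fun s ⟨hs, hs'⟩ => ?_, dTopology_opens ▸ hopen, hrS,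
    by rwa [Set.mem_preimage, hrσ]⟩
  have heq : (⟨σ s, hs⟩ : S) = ⟨σ' s, hs'⟩ := e.injective (Subtype.ext (by simp only [hfst]; rfl))
  exact congrArg (fun z : S => z.1.1.2) heq

theorem isDiffEtale_of_hasUniqueLocalLifts (hπ : DSmooth π) (hex : HasLocalLifts π)
    (huniq : HasUniqueLocalLifts π) : IsDiffEtale π := by
  refine ⟨hπ, fun d U P hP z => ?_⟩
  obtain ⟨O, hOU, hr, L, hL, hLr, hπL⟩ := hex d U P hP z.1.1 z.1.2 z.2
  let S : Set (Function.Pullback P π) := {z | ∃ hz : z.1.1.1 ∈ O, L ⟨z.1.1, hz⟩ = z.1.2}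
  let S' : Set U := Subtype.val ⁻¹' (O : Set (Eucl d))
  let e : S ≃ S' :=
    { toFun z := ⟨z.1.1.1, z.2.1⟩
      invFun r := ⟨⟨(r.1, L ⟨r.1, r.2⟩), (hπL ⟨r.1, r.2⟩).symm⟩, r.2, rfl⟩
      left_inv z := Subtype.ext (Subtype.ext (Prod.ext rfl z.2.2))
      right_inv r := rfl }
  refine ⟨S, S', isOpen_iff_preimages_plots.2 fun n p hp => ?_,
    dTopology_opens ▸ O.isOpen.preimage continuous_subtype_val, ⟨hr, hLr⟩, hr, e,
    fun n p hp => hp.1, fun n p hp => ⟨hp, hL n _ hp⟩, fun _ => rfl⟩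
  have hp₁ : IsPlot fun t => (p t).1.1.1 := hp.1
  let O₁ : Opens (Eucl n) := ⟨_, O.isOpen.preimage hp₁.contDiff.continuous⟩
  have hopen := huniq n O₁ (fun t => L ⟨(p t).1.1.1, t.2⟩) (fun t => (p t).1.2)
    (fun k q hq => hL k _ (isPlot_reparam hp₁ (IsPlot.contDiff hq)))
    (fun k q hq => isPlot_reparam hp.2 (IsPlot.contDiff hq))
    (funext fun t => (hπL _).trans (p t).2)
  convert O₁.isOpen.isOpenEmbedding_subtypeVal.isOpenMap _ hopen using 1
  ext t
  exact ⟨fun ⟨ht, h⟩ => ⟨⟨t, ht⟩, h, rfl⟩, fun ⟨⟨_, ht⟩, h, e⟩ => e ▸ ⟨ht, h⟩⟩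

theorem isDiffEtale_of_injective (hπ : DSmooth π) (hinj : Function.Injective π)
    (hex : HasLocalLifts π) : IsDiffEtale π :=
  isDiffEtale_of_hasUniqueLocalLifts hπ hex fun _ _ L L' _ _ h => by
    simp [hinj.comp_left h]

theorem HasUniqueLocalLifts.comp {Z : Type*} {ρ : X → Z} (hρ : HasUniqueLocalLifts ρ)
    (hπ' : DSmooth π) (hπ : HasUniqueLocalLifts π) : HasUniqueLocalLifts (ρ ∘ π) := by
  intro d O L L' hL hL' h
  have hO' : IsOpen {r | (π ∘ L) r = (π ∘ L') r} :=
    hρ d O _ _ (hπ'.comp hL) (hπ'.comp hL') h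
  let O' : Opens (Eucl d) := ⟨_, O.isOpen.isOpenEmbedding_subtypeVal.isOpenMap _ hO'⟩
  have hsub (r : O') : ∃ hr : r.1 ∈ O, π (L ⟨r, hr⟩) = π (L' ⟨r, hr⟩) := by
    obtain ⟨_, s, hs, rfl⟩ := r
    exact ⟨s.2, hs⟩
  have hopen := hπ d O' (fun r => L ⟨r, (hsub r).1⟩) (fun r => L' ⟨r, (hsub r).1⟩)
    (fun n p hp => hL n _ hp) (fun n p hp => hL' n _ hp) (funext fun r => (hsub r).2)
  convert (O'.isOpen.isOpenEmbedding_subtypeVal.isOpenMap _ hopen).preimage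
    (continuous_subtype_val (p := (· ∈ O))) using 1
  ext r
  exact ⟨fun hr => ⟨⟨r, r, congrArg π hr, rfl⟩, hr, rfl⟩,
    fun ⟨s, hs, hsr⟩ => by obtain ⟨s, _⟩ := s; subst hsr; exact hs⟩

theorem HasLocalLifts.comp {ρ : X → Y} (hρ : HasLocalLifts ρ) (hπ : HasLocalLifts π) :
    HasLocalLifts (ρ ∘ π) := by
  intro d U P hP r e hre
  obtain ⟨O, hOU, hr, L, hL, hLr, hρL⟩ := hρ d U P hP r (π e) hre
  obtain ⟨O', hO'O, hr', L', hL', hLr', hπL'⟩ := hπ d O L hL ⟨r, hr⟩ e hLr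
  exact ⟨O', fun x hx => hOU x (hO'O x hx), hr', L', hL', hLr', fun s => by
    rw [Function.comp_apply, hπL', hρL]⟩

theorem IsDiffEtale.comp {ρ : X → Y} (hρ : IsDiffEtale ρ) (hπ : IsDiffEtale π) :
    IsDiffEtale (ρ ∘ π) :=
  isDiffEtale_of_hasUniqueLocalLifts (hρ.1.comp hπ.1) (hρ.hasLocalLifts.comp hπ.hasLocalLifts)
    (hρ.hasUniqueLocalLifts.comp hπ.1 hπ.hasUniqueLocalLifts)

theorem IsPartialDiffeo.isDiffEtale_symm {d : ℕ} {α : OpenPartialHomeomorph (Eucl d) (Eucl d)}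
    (hα : IsPartialDiffeo ∞ α) {U : Opens (Eucl d)} (hU : ∀ x ∈ α.source, x ∈ U) :
    IsDiffEtale fun y : (⟨α.target, α.open_target⟩ : Opens (Eucl d)) =>
      (⟨α.symm y, hU _ (α.map_target y.2)⟩ : U) := by
  refine isDiffEtale_of_injective (dSmooth_restrict hα.contDiffOn_symm) (fun y y' h =>
    Subtype.ext (α.symm.injOn y.2 y'.2 (congrArg Subtype.val h))) fun n W P hP r e hre => ?_
  have hP' : ContDiffOn ℝ ∞ (zeroExtend fun r => (P r : Eucl d)) W := contDiffOn_zeroExtend hP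
  let O : Opens (Eucl n) := ⟨_, hP'.continuousOn.isOpen_inter_preimage W.isOpen α.open_source⟩
  have hPO (s : O) : (P ⟨s, s.2.1⟩ : Eucl d) ∈ α.source := by
    have := s.2.2
    rwa [Set.mem_preimage, zeroExtend_coe (fun r => (P r : Eucl d)) ⟨s, s.2.1⟩] at this
  have hre' : (P r : Eucl d) = α.symm e := congrArg Subtype.val hre
  refine ⟨O, fun x hx => hx.1, ⟨r.2, ?_⟩, fun s => ⟨α (P ⟨s, s.2.1⟩), α.map_source (hPO s)⟩,
    ?_, Subtype.ext ?_, fun s => Subtype.ext (α.left_inv (hPO s))⟩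
  · rw [Set.mem_preimage, zeroExtend_coe, hre']
    exact α.map_target e.2
  · exact fun k p hp => (hα.contDiffOn.comp_contDiff
      (IsPlot.contDiff (hP k (fun t => ⟨p t, (p t).2.1⟩) hp)) fun t => hPO (p t)).isPlot
  · exact (congrArg α hre').trans (α.right_inv e.2)

end Etale

/-! ### Tangent maps of étale maps and of maps between domains -/

section Tangent

variable {E X Y : Type*} [DiffeologicalSpace E] [DiffeologicalSpace X] [DiffeologicalSpace Y]
  {x : X} {P Q R : CenteredPlot X x}

theorem IsGermHom.comp {G : Eucl Q.dim → Eucl R.dim} {F : Eucl P.dim → Eucl Q.dim}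
    (hG : IsGermHom Q R G) (hF : IsGermHom P Q F) : IsGermHom P R (G ∘ F) := by
  obtain ⟨hF0, W, h0, hFW, hPQ⟩ := hF
  obtain ⟨hG0, W', h0', hGW', hQR⟩ := hG
  refine ⟨by simp [hF0, hG0],
    ⟨W ∩ F ⁻¹' W', hFW.continuousOn.isOpen_inter_preimage W.isOpen W'.isOpen⟩,
    ⟨h0, by rwa [Set.mem_preimage, hF0]⟩,
    hGW'.comp (hFW.mono Set.inter_subset_left) fun r hr => hr.2, fun r hr => ?_⟩
  obtain ⟨hP, _, hPF⟩ := hPQ r hr.1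
  obtain ⟨_, hR, hQG⟩ := hQR _ hr.2
  exact ⟨hP, hR, hPF.trans hQG⟩

theorem IsGermHom.differentiableAt {F : Eucl P.dim → Eucl Q.dim} (hF : IsGermHom P Q F) :
    DifferentiableAt ℝ F 0 := by
  obtain ⟨-, W, h0, hFW, -⟩ := hF
  exact (hFW.contDiffAt (W.isOpen.mem_nhds h0)).differentiableAt (by simp)

theorem tangentMap_comp {g : X → Y} {f : E → X} (hg : DSmooth g) (hf : DSmooth f) (e : E) :
    tangentMap hg (f e) ∘ₗ tangentMap hf e = tangentMap (hg.comp hf) e :=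
  tangent_hom_ext fun P v => by
    rw [LinearMap.comp_apply, tangentMap_plotDiff]
    exact (tangentMap_plotDiff hg (P.map hf) v).trans (tangentMap_plotDiff (hg.comp hf) P v).symm

namespace IsDiffEtale

variable {π : E → X} (hπ : IsDiffEtale π) {e : E}

theorem isGermHom_of_map {P Q : CenteredPlot E e} {F : Eucl Q.dim → Eucl P.dim}
    (hF : IsGermHom (Q.map hπ.1) (P.map hπ.1) F) : IsGermHom Q P F := by
  obtain ⟨hF0, W, h0, hFW, hQP⟩ := hF
  let L (r : W) : E := Q.toFun ⟨r.1, (hQP r.1 r.2).1⟩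
  let L' (r : W) : E := P.toFun ⟨F r.1, (hQP r.1 r.2).2.1⟩
  have hL : DSmooth L := fun n p hp => Q.smooth n _ hp
  have hL' : DSmooth L' := fun n p hp => P.smooth n _ (dSmooth_restrict hFW n p hp)
  have hopen := hπ.hasUniqueLocalLifts _ W L L' hL hL' (funext fun r => (hQP r.1 r.2).2.2)
  refine ⟨hF0, ⟨_, W.isOpen.isOpenEmbedding_subtypeVal.isOpenMap _ hopen⟩, ⟨⟨0, h0⟩, ?_, rfl⟩,
    hFW.mono ?_, ?_⟩
  · have hP0 : P.toFun ⟨F 0, (hQP 0 h0).2.1⟩ = P.toFun ⟨0, P.zero_mem⟩ :=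
      congrArg P.toFun (Subtype.ext hF0)
    exact Q.map_zero.trans (P.map_zero.symm.trans hP0.symm)
  · rintro _ ⟨r, -, rfl⟩
    exact r.2
  · rintro _ ⟨r, hr, rfl⟩
    exact ⟨_, _, hr⟩

/-- A lift along a diffeological étale map of the germ of a centered plot; it is a restriction of
the plot to a smaller domain, lifted to the total space. -/
noncomputable def lift (P : CenteredPlot X (π e)) : CenteredPlot E e :=
  have h := hπ.hasLocalLifts P.dim P.dom P.toFun P.smooth ⟨0, P.zero_mem⟩ e P.map_zero
  have hL := h.choose_spec.choose_spec.choose_spec.choose_spec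
  { dim := P.dim
    dom := h.choose
    zero_mem := h.choose_spec.choose_spec.choose
    toFun := h.choose_spec.choose_spec.choose_spec.choose
    smooth := hL.1
    map_zero := hL.2.1 }

theorem lift_spec (P : CenteredPlot X (π e)) (r : Eucl P.dim) (hr : r ∈ (hπ.lift P).dom) :
    ∃ hP : r ∈ P.dom, π ((hπ.lift P).toFun ⟨r, hr⟩) = P.toFun ⟨r, hP⟩ :=
  have h := hπ.hasLocalLifts P.dim P.dom P.toFun P.smooth ⟨0, P.zero_mem⟩ e P.map_zero
  ⟨_, h.choose_spec.choose_spec.choose_spec.choose_spec.2.2 ⟨r, hr⟩⟩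

theorem isGermHom_map_lift (P : CenteredPlot X (π e)) :
    IsGermHom ((hπ.lift P).map hπ.1) P id :=
  ⟨rfl, (hπ.lift P).dom, (hπ.lift P).zero_mem, contDiffOn_id,
    fun r hr => ⟨hr, (hπ.lift_spec P r hr).1, (hπ.lift_spec P r hr).2⟩⟩

theorem isGermHom_to_map_lift (P : CenteredPlot X (π e)) :
    IsGermHom P ((hπ.lift P).map hπ.1) id :=
  ⟨rfl, (hπ.lift P).dom, (hπ.lift P).zero_mem, contDiffOn_id,
    fun r hr => ⟨(hπ.lift_spec P r hr).1, hr, (hπ.lift_spec P r hr).2.symm⟩⟩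

/-- The differential of the lift of a centered plot; these maps form the cocone defining the
inverse of the tangent map of `π`. -/
noncomputable def liftDiff (P : CenteredPlot X (π e)) :
    Eucl P.dim →ₗ[ℝ] InternalTangentSpace E e :=
  plotDiff (hπ.lift P)

theorem liftDiff_fderiv {P Q : CenteredPlot X (π e)} {F : Eucl Q.dim → Eucl P.dim}
    (hF : IsGermHom Q P F) (v : Eucl Q.dim) :
    hπ.liftDiff P (fderiv ℝ F 0 v) = hπ.liftDiff Q v :=
  plotDiff_fderiv (hπ.isGermHom_of_map
    ((hπ.isGermHom_to_map_lift P).comp (hF.comp (hπ.isGermHom_map_lift Q)))) v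

theorem liftDiff_map (P : CenteredPlot E e) (v : Eucl P.dim) :
    hπ.liftDiff (P.map hπ.1) v = plotDiff P v := by
  have hid : fderiv ℝ (id : Eucl P.dim → Eucl P.dim) 0 v = v := by rw [fderiv_id]; rfl
  refine (congrArg (hπ.liftDiff (P.map hπ.1)) hid).symm.trans ?_
  exact plotDiff_fderiv (hπ.isGermHom_of_map (hπ.isGermHom_to_map_lift (P.map hπ.1))) v

theorem tangentMap_liftDiff (P : CenteredPlot X (π e)) (v : Eucl P.dim) :
    tangentMap hπ.1 e (hπ.liftDiff P v) = plotDiff P v := by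
  have hid : fderiv ℝ (id : Eucl P.dim → Eucl P.dim) 0 v = v := by rw [fderiv_id]; rfl
  refine (tangentMap_plotDiff hπ.1 (hπ.lift P) v).trans ?_
  exact (congrArg (plotDiff ((hπ.lift P).map hπ.1)) hid).symm.trans
    (plotDiff_fderiv (hπ.isGermHom_to_map_lift P) v)

theorem bijective_tangentMap (e : E) : Function.Bijective (tangentMap hπ.1 e) := by
  let T : InternalTangentSpace X (π e) →ₗ[ℝ] InternalTangentSpace E e :=
    tangentDesc hπ.liftDiff fun _ _ _ hF => hπ.liftDiff_fderiv hF
  have hT (P : CenteredPlot X (π e)) (v : Eucl P.dim) : T (plotDiff P v) = hπ.liftDiff P v :=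
    tangentDesc_plotDiff _ _ P v
  have hleft : T ∘ₗ tangentMap hπ.1 e = .id := tangent_hom_ext fun P v => by
    rw [LinearMap.comp_apply, tangentMap_plotDiff]
    exact (hT (P.map hπ.1) v).trans (hπ.liftDiff_map P v)
  have hright : tangentMap hπ.1 e ∘ₗ T = .id := tangent_hom_ext fun P v => by
    rw [LinearMap.comp_apply, hT]
    exact hπ.tangentMap_liftDiff P v
  exact Function.bijective_iff_has_inverse.2
    ⟨T, DFunLike.congr_fun hleft, DFunLike.congr_fun hright⟩

theorem finrank_range_tangentMap_comp_right {f : X → Y} (hf : DSmooth f) (e : E) :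
    Module.finrank ℝ (tangentMap (hf.comp hπ.1) e).range =
      Module.finrank ℝ (tangentMap hf (π e)).range := by
  rw [← tangentMap_comp hf hπ.1, LinearMap.range_comp_of_range_eq_top _
    (LinearMap.range_eq_top.2 (hπ.bijective_tangentMap e).surjective)]
  rfl

theorem finrank_range_tangentMap_comp_left {f : Y → E} (hf : DSmooth f) (y : Y) :
    Module.finrank ℝ (tangentMap (hπ.1.comp hf) y).range =
      Module.finrank ℝ (tangentMap hf y).range := by
  rw [← tangentMap_comp hπ.1 hf, LinearMap.range_comp]
  exact (Submodule.equivMapOfInjective _ (hπ.bijective_tangentMap _).injective _).finrank_eq.symm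

end IsDiffEtale

end Tangent

section TangentDomain

variable {d n : ℕ} {U : Opens (Eucl d)} {V : Opens (Eucl n)}

/-- The plot `r ↦ u + r` of a domain, centered at `u`. -/
def basePlot (u : U) : CenteredPlot U u where
  dim := d
  dom := ⟨(u.1 + ·) ⁻¹' U, U.isOpen.preimage (by fun_prop)⟩
  zero_mem := by
    change u.1 + 0 ∈ U
    simp
  toFun r := ⟨u.1 + r.1, r.2⟩
  smooth _ _ hp := ((contDiff_const (c := u.1)).add (IsPlot.contDiff hp)).isPlot
  map_zero := Subtype.ext (add_zero u.1)

/-- The local representative `dom P → ℝᵈ` of a centered plot of a domain, extended by zero. -/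
noncomputable def CenteredPlot.extend {u : U} (P : CenteredPlot U u) : Eucl P.dim → Eucl d :=
  zeroExtend fun r => (P.toFun r : Eucl d)

theorem CenteredPlot.contDiffOn_extend {u : U} (P : CenteredPlot U u) :
    ContDiffOn ℝ ∞ P.extend P.dom :=
  contDiffOn_zeroExtend P.smooth

theorem CenteredPlot.extend_coe {u : U} (P : CenteredPlot U u) (r : P.dom) :
    P.extend r = P.toFun r :=
  zeroExtend_coe _ r

theorem CenteredPlot.extend_zero {u : U} (P : CenteredPlot U u) : P.extend 0 = u :=
  (P.extend_coe ⟨0, P.zero_mem⟩).trans (congrArg Subtype.val P.map_zero)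

theorem CenteredPlot.differentiableAt_extend {u : U} (P : CenteredPlot U u) :
    DifferentiableAt ℝ P.extend 0 :=
  (P.contDiffOn_extend.contDiffAt (P.dom.isOpen.mem_nhds P.zero_mem)).differentiableAt (by simp)

theorem CenteredPlot.isGermHom_basePlot {u : U} (P : CenteredPlot U u) :
    IsGermHom P (basePlot u) (fun r => P.extend r - u.1 : Eucl P.dim → Eucl d) := by
  have hadd (r : Eucl P.dim) : u.1 + (P.extend r - u.1) = P.extend r := add_sub_cancel _ _
  refine ⟨sub_eq_zero.2 P.extend_zero, P.dom, P.zero_mem,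
    P.contDiffOn_extend.sub contDiffOn_const, fun r hr => ?_⟩
  have hr' : u.1 + (P.extend r - u.1) = P.toFun ⟨r, hr⟩ := (hadd r).trans (P.extend_coe ⟨r, hr⟩)
  exact ⟨hr, (congrArg (· ∈ U) hr').mpr (P.toFun ⟨r, hr⟩).2, Subtype.ext hr'.symm⟩

theorem plotDiff_basePlot_fderiv_extend {u : U} (P : CenteredPlot U u) (v : Eucl P.dim) :
    plotDiff (basePlot u) (fderiv ℝ P.extend 0 v) = plotDiff P v := by
  rw [← plotDiff_fderiv P.isGermHom_basePlot v]
  exact congrArg (fun A : Eucl P.dim →L[ℝ] Eucl d => plotDiff (basePlot u) (A v))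
    (fderiv_sub_const u.1).symm

theorem IsGermHom.fderiv_extend {u : U} {P Q : CenteredPlot U u} {F : Eucl Q.dim → Eucl P.dim}
    (hF : IsGermHom Q P F) (v : Eucl Q.dim) :
    fderiv ℝ P.extend 0 (fderiv ℝ F 0 v) = fderiv ℝ Q.extend 0 v := by
  have hcomp : Q.extend =ᶠ[𝓝 0] P.extend ∘ F := by
    obtain ⟨-, W, h0, -, hQP⟩ := hF
    filter_upwards [W.isOpen.mem_nhds h0] with r hr
    obtain ⟨hQ, hP, hrF⟩ := hQP r hr
    rw [Function.comp_apply, Q.extend_coe ⟨r, hQ⟩, P.extend_coe ⟨F r, hP⟩, hrF]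
  have hP : DifferentiableAt ℝ P.extend (F 0) := hF.1.symm ▸ P.differentiableAt_extend
  rw [hcomp.fderiv_eq, fderiv_comp 0 hP hF.differentiableAt, hF.1]
  rfl

theorem fderiv_extend_basePlot (u : U) :
    fderiv ℝ (basePlot u).extend (0 : Eucl d) = .id ℝ (Eucl d) := by
  have heq : (basePlot u).extend =ᶠ[𝓝 (0 : Eucl d)] fun r : Eucl d => u.1 + r := by
    filter_upwards [(basePlot u).dom.isOpen.mem_nhds (basePlot u).zero_mem] with r hr
    exact (basePlot u).extend_coe ⟨r, hr⟩
  exact heq.fderiv_eq.trans ((fderiv_const_add u.1).trans fderiv_fun_id)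

/-- The linear map from the internal tangent space at `u` of a `d`-domain to `ℝᵈ` that sends
`dP₀ v` to the derivative at `0`, in the direction `v`, of the local representative of `P`. -/
noncomputable def tangentCoord (u : U) : InternalTangentSpace U u →ₗ[ℝ] Eucl d :=
  tangentDesc (fun P => (fderiv ℝ P.extend 0).toLinearMap) fun _ _ _ hF => hF.fderiv_extend

theorem tangentCoord_plotDiff {u : U} (P : CenteredPlot U u) (v : Eucl P.dim) :
    tangentCoord u (plotDiff P v) = fderiv ℝ P.extend 0 v :=
  tangentDesc_plotDiff _ _ P v

/-- The canonical identification of `ℝᵈ` with the internal tangent space of a `d`-domain. -/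
noncomputable def tangentEquiv (u : U) : Eucl d ≃ₗ[ℝ] InternalTangentSpace U u :=
  .ofLinearMap (plotDiff (basePlot u)) (tangentCoord u)
    (tangent_hom_ext fun P v =>
      (congrArg (plotDiff (basePlot u)) (tangentCoord_plotDiff P v)).trans
        (plotDiff_basePlot_fderiv_extend P v))
    (LinearMap.ext fun v => (tangentCoord_plotDiff (basePlot u) v).trans
      (DFunLike.congr_fun (fderiv_extend_basePlot u) v))

theorem fderiv_extend_map_basePlot {F : U → V} (hF : DSmooth F) (u : U) :
    fderiv ℝ ((basePlot u).map hF).extend (0 : Eucl d) =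
      fderiv ℝ (zeroExtend fun r => (F r : Eucl n)) u := by
  have heq : ((basePlot u).map hF).extend =ᶠ[𝓝 (0 : Eucl d)]
      fun r : Eucl d => zeroExtend (fun r => (F r : Eucl n)) (u.1 + r) := by
    filter_upwards [(basePlot u).dom.isOpen.mem_nhds (basePlot u).zero_mem] with r hr
    exact (((basePlot u).map hF).extend_coe ⟨r, hr⟩).trans
      (zeroExtend_coe (fun r => (F r : Eucl n)) ⟨u.1 + r, hr⟩).symm
  refine heq.fderiv_eq.trans ((fderiv_comp_add_left u.1).trans ?_)
  rw [add_zero]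

theorem tangentMap_tangentEquiv {F : U → V} (hF : DSmooth F) (u : U) (v : Eucl d) :
    tangentMap hF u (tangentEquiv u v) =
      tangentEquiv (F u) (fderiv ℝ (zeroExtend fun r => (F r : Eucl n)) u v) := by
  refine (tangentMap_plotDiff hF (basePlot u) v).trans ?_
  rw [← fderiv_extend_map_basePlot hF u]
  exact (plotDiff_basePlot_fderiv_extend ((basePlot u).map hF) v).symm

theorem finrank_range_tangentMap_eq_finrank_range_fderiv {F : U → V} (hF : DSmooth F) (u : U) :
    Module.finrank ℝ (tangentMap hF u).range =
      Module.finrank ℝ (fderiv ℝ (zeroExtend fun r => (F r : Eucl n)) u).range := by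
  have hcomp : tangentMap hF u ∘ₗ (tangentEquiv u).toLinearMap =
      (tangentEquiv (F u)).toLinearMap ∘ₗ
        (fderiv ℝ (zeroExtend fun r => (F r : Eucl n)) u).toLinearMap :=
    LinearMap.ext (tangentMap_tangentEquiv hF u)
  rw [← LinearMap.range_comp_of_range_eq_top _ (tangentEquiv u).range, hcomp,
    LinearMap.range_comp, LinearEquiv.finrank_map_eq]

end TangentDomain

/-! ### The rank theorem -/

section NormalForm

variable {m n p k : ℕ}

/-- `rankNormalForm` as a linear map. -/
def rankNormalFormₗ (m n k : ℕ) (hkm : k ≤ m) : Eucl m →ₗ[ℝ] Eucl n where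
  toFun := rankNormalForm m n k hkm
  map_add' x y := by
    ext i
    by_cases hi : i.1 < k <;> simp [rankNormalForm, hi]
  map_smul' c x := by
    ext i
    by_cases hi : i.1 < k <;> simp [rankNormalForm, hi]

theorem rankNormalFormₗ_comp (hkm : k ≤ m) (hkn : k ≤ n) :
    rankNormalFormₗ n p k hkn ∘ₗ rankNormalFormₗ m n k hkm = rankNormalFormₗ m p k hkm := by
  ext x i
  by_cases hi : i.1 < k <;> simp [rankNormalFormₗ, rankNormalForm, hi]

theorem rankNormalFormₗ_self : rankNormalFormₗ k k k le_rfl = LinearMap.id := by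
  ext x i
  simp [rankNormalFormₗ, rankNormalForm]

theorem finrank_range_rankNormalFormₗ (hkm : k ≤ m) (hkn : k ≤ n) :
    Module.finrank ℝ (rankNormalFormₗ m n k hkm).range = k := by
  have hsurj : Function.Surjective (rankNormalFormₗ m k k hkm) :=
    (Function.RightInverse.surjective (g := rankNormalFormₗ k m k le_rfl)) fun x =>
      LinearMap.congr_fun ((rankNormalFormₗ_comp le_rfl hkm).trans rankNormalFormₗ_self) x
  have hinj : Function.Injective (rankNormalFormₗ k n k le_rfl) :=
    (Function.LeftInverse.injective (g := rankNormalFormₗ n k k hkn)) fun x =>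
      LinearMap.congr_fun ((rankNormalFormₗ_comp le_rfl hkn).trans rankNormalFormₗ_self) x
  rw [← rankNormalFormₗ_comp hkm le_rfl,
    LinearMap.range_comp_of_range_eq_top _ (LinearMap.range_eq_top.2 hsurj),
    LinearMap.finrank_range_of_inj hinj, finrank_euclideanSpace_fin]

theorem exists_isPartialDiffeo_rankNormalForm {r : ℕ∞ω} (hr : r ≠ 0)
    {f : Eucl m → Eucl n} {O : Set (Eucl m)} (hO : IsOpen O) (hf : ContDiffOn ℝ r f O)
    (hrank : ∀ x ∈ O, Module.finrank ℝ (fderiv ℝ f x).range = k) {x₀ : Eucl m} (hx₀ : x₀ ∈ O)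
    (hkm : k ≤ m) (hkn : k ≤ n) :
    ∃ (α : OpenPartialHomeomorph (Eucl m) (Eucl m)) (β : OpenPartialHomeomorph (Eucl n) (Eucl n)),
      IsPartialDiffeo r α ∧ IsPartialDiffeo r β ∧ x₀ ∈ α.source ∧ α.source ⊆ O ∧
      Set.MapsTo f α.source β.source ∧
      ∀ x ∈ α.source, β (f x) = rankNormalForm m n k hkm (α x) := by
  obtain ⟨α, β, hα, hβ, hx₀α, hαO, hmaps, hαβ⟩ :=
    exists_isPartialDiffeo_comp_eq_fderiv_comp hr hO hf hx₀ fun x hx =>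
      (hrank x hx).trans (hrank x₀ hx₀).symm
  obtain ⟨a, b, hab⟩ := exists_linearEquiv_comp_eq_comp
    ((hrank x₀ hx₀).trans (finrank_range_rankNormalFormₗ hkm hkn).symm)
  exact ⟨_, _, hα.transContinuousLinearEquiv a.toContinuousLinearEquiv,
    hβ.transContinuousLinearEquiv b.toContinuousLinearEquiv, hx₀α, hαO, hmaps,
    fun x hx => (congrArg b (hαβ x hx)).trans (hab (α x))⟩

end NormalForm

section RankTheorem

variable {M N : Type*} [DiffeologicalSpace M] [DiffeologicalSpace N] {f : M → N} {m n k : ℕ}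

theorem finrank_range_tangentMap_congr {f g : M → N} (hfg : f = g) (hf : DSmooth f)
    (hg : DSmooth g) (x : M) :
    Module.finrank ℝ (tangentMap hf x).range = Module.finrank ℝ (tangentMap hg x).range := by
  subst hfg
  rfl

variable {U : Opens (Eucl m)} {V : Opens (Eucl n)} {φ : U → M} {ψ : V → N}

theorem finrank_range_tangentMap_eq_of_comp_eq (hf : DSmooth f) (hφ : IsDiffEtale φ)
    (hψ : IsDiffEtale ψ) {F : U → V} (hF : DSmooth F) (hcomm : f ∘ φ = ψ ∘ F) (u : U) :
    Module.finrank ℝ (tangentMap hf (φ u)).range =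
      Module.finrank ℝ (fderiv ℝ (zeroExtend fun r => (F r : Eucl n)) u).range :=
  calc
    _ = Module.finrank ℝ (tangentMap (hf.comp hφ.1) u).range :=
      (hφ.finrank_range_tangentMap_comp_right hf u).symm
    _ = Module.finrank ℝ (tangentMap (hψ.1.comp hF) u).range :=
      finrank_range_tangentMap_congr hcomm _ _ u
    _ = Module.finrank ℝ (tangentMap hF u).range := hψ.finrank_range_tangentMap_comp_left hF u
    _ = _ := finrank_range_tangentMap_eq_finrank_range_fderiv hF u

theorem exists_isDiffEtale_comp_eq_comp (hf : DSmooth f) (hφ : IsDiffEtale φ)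
    (hψ : IsDiffEtale ψ) {u : U} {v : V} (huv : f (φ u) = ψ v) :
    ∃ (O : Opens (Eucl m)) (hOU : O ≤ U) (F : O → V), u.1 ∈ O ∧ DSmooth F ∧
      IsDiffEtale (φ ∘ Opens.inclusion hOU) ∧ (f ∘ φ ∘ Opens.inclusion hOU = ψ ∘ F) := by
  obtain ⟨O, hOU, hu, F, hF, -, hψF⟩ :=
    hψ.hasLocalLifts m U (f ∘ φ) (hf.comp hφ.1) u v huv
  exact ⟨O, hOU, F, hu, hF, hφ.comp ((IsPartialDiffeo.ofSet O.isOpen).isDiffEtale_symm hOU),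
    funext fun r => (hψF r).symm⟩

theorem exists_isDiffEtale_eq_rankNormalForm (hφ : IsDiffEtale φ) (hψ : IsDiffEtale ψ)
    {F : U → V} (hF : DSmooth F) (hcomm : f ∘ φ = ψ ∘ F)
    (hrank : ∀ u : U,
      Module.finrank ℝ (fderiv ℝ (zeroExtend fun r => (F r : Eucl n)) u).range = k)
    (u : U) (hkm : k ≤ m) (hkn : k ≤ n) :
    ∃ (U' : Opens (Eucl m)) (V' : Opens (Eucl n)) (φ' : U' → M) (ψ' : V' → N),
      IsDiffEtale φ' ∧ IsDiffEtale ψ' ∧ φ u ∈ Set.range φ' ∧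
      ∃ hV' : ∀ r : U', rankNormalForm m n k hkm r ∈ V',
        ∀ r : U', f (φ' r) = ψ' ⟨rankNormalForm m n k hkm r, hV' r⟩ := by
  let Fx : Eucl m → Eucl n := zeroExtend fun r => (F r : Eucl n)
  have hFx (r : U) : Fx r = F r := zeroExtend_coe _ r
  obtain ⟨α, β, hα, hβ, huα, hαU, hmaps, hαβ⟩ := exists_isPartialDiffeo_rankNormalForm (by simp)
    U.isOpen (contDiffOn_zeroExtend hF) (fun x hx => hrank ⟨x, hx⟩) u.2 hkm hkn
  let β' := (OpenPartialHomeomorph.ofSet V V.isOpen).trans β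
  have hβ' : IsPartialDiffeo ∞ β' := (IsPartialDiffeo.ofSet V.isOpen).trans hβ
  have hβ'V : ∀ y ∈ β'.source, y ∈ V := fun y hy => hy.1
  let φα (r : (⟨α.target, α.open_target⟩ : Opens (Eucl m))) : U :=
    ⟨α.symm r, hαU (α.map_target r.2)⟩
  have hmem (r) : (F (φα r) : Eucl n) ∈ β'.source :=
    ⟨(F (φα r)).2, hFx (φα r) ▸ hmaps (α.map_target r.2)⟩
  have hnf (r) : β' (F (φα r)) = rankNormalForm m n k hkm r := by
    have h := hαβ _ (α.map_target r.2)
    rw [α.right_inv r.2] at h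
    exact (congrArg β (hFx (φα r))).symm.trans h
  refine ⟨_, _, φ ∘ φα, _, hφ.comp (hα.isDiffEtale_symm hαU),
    hψ.comp (hβ'.isDiffEtale_symm hβ'V), ⟨⟨α u, α.map_source huα⟩, ?_⟩,
    fun r => hnf r ▸ β'.map_source (hmem r), fun r => ?_⟩
  · exact congrArg φ (Subtype.ext (α.left_inv huα))
  · refine (congrFun hcomm (φα r)).trans (congrArg ψ (Subtype.ext ?_))
    exact ((congrArg β'.symm (hnf r)).symm.trans (β'.left_inv (hmem r))).symm

end RankTheorem

end EtaleDiffeology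

open EtaleDiffeology in
theorem theorem6p8_general {M N : Type*} [DiffeologicalSpace M] [DiffeologicalSpace N]
    {m n k : ℕ} {U : TopologicalSpace.Opens (Eucl m)} {V : TopologicalSpace.Opens (Eucl n)}
    {φ : U → M} {ψ : V → N} (hφ : IsDiffEtale φ) (hψ : IsDiffEtale ψ) {f : M → N}
    (hf : Diffeology.DSmooth f) (hk : ∀ u, (tangentMap hf (φ u)).rank = (k : Cardinal))
    {u : U} {v : V} (huv : f (φ u) = ψ v) :
    ∃ (hkm : k ≤ m) (_ : k ≤ n) (U' : TopologicalSpace.Opens (Eucl m))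
      (V' : TopologicalSpace.Opens (Eucl n)) (φ' : U' → M) (ψ' : V' → N),
      IsDiffEtale φ' ∧ IsDiffEtale ψ' ∧ φ u ∈ Set.range φ' ∧ f (φ u) ∈ Set.range ψ' ∧
      ∃ hF : ∀ r : U', rankNormalForm m n k hkm r ∈ V',
        ∀ r : U', f (φ' r) = ψ' ⟨rankNormalForm m n k hkm r, hF r⟩ := by
  obtain ⟨O, hOU, F, hu, hF, hφO, hcomm⟩ := exists_isDiffEtale_comp_eq_comp hf hφ hψ huv
  have hrank (r : O) :
      Module.finrank ℝ (fderiv ℝ (zeroExtend fun s => (F s : Eucl n)) r).range = k :=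
    (finrank_range_tangentMap_eq_of_comp_eq hf hφO hψ hF hcomm r).symm.trans
      (Module.finrank_eq_of_rank_eq (hk _))
  have hkm : k ≤ m := hrank ⟨u, hu⟩ ▸ (LinearMap.finrank_range_le _).trans_eq (by simp)
  have hkn : k ≤ n := hrank ⟨u, hu⟩ ▸ (Submodule.finrank_le _).trans_eq (by simp)
  obtain ⟨U', V', φ', ψ', hφ', hψ', ⟨r, hr⟩, hV', hnf⟩ :=
    exists_isDiffEtale_eq_rankNormalForm hφO hψ hF hcomm hrank ⟨u, hu⟩ hkm hkn
  replace hr : φ' r = φ u := hr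
  exact ⟨hkm, hkn, U', V', φ', ψ', hφ', hψ', ⟨r, hr⟩, ⟨_, (hr ▸ hnf r).symm⟩, hV', hnf⟩

theorem theorem6p8 {M N : Type*} [DiffeologicalSpace M] [DiffeologicalSpace N] (m n k : ℕ)
    (hM : EtaleDiffeology.IsEtaleManifold m M) (hN : EtaleDiffeology.IsEtaleManifold n N)
    (f : M → N) (hf : Diffeology.DSmooth f)
    (hk : EtaleDiffeology.HasConstantInternalRank hf k) (x : M) :
    ∃ (hkm : k ≤ m) (_ : k ≤ n)
      (U : TopologicalSpace.Opens (EuclideanSpace ℝ (Fin m)))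
      (V : TopologicalSpace.Opens (EuclideanSpace ℝ (Fin n)))
      (φ : U → M) (ψ : V → N),
      EtaleDiffeology.IsDiffEtale φ ∧ EtaleDiffeology.IsDiffEtale ψ ∧
      x ∈ Set.range φ ∧ f x ∈ Set.range ψ ∧
      ∃ hF : ∀ r : U, EtaleDiffeology.rankNormalForm m n k hkm r ∈ V,
        ∀ r : U, f (φ r) = ψ ⟨EtaleDiffeology.rankNormalForm m n k hkm r, hF r⟩ := by
  obtain ⟨A, hA, hAM⟩ := hM
  obtain ⟨B, hB, hBN⟩ := hN
  obtain ⟨⟨U, φ⟩, hφ, u, rfl⟩ := hAM x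
  obtain ⟨⟨V, ψ⟩, hψ, v, hv⟩ := hBN (f (φ u))
  exact theorem6p8_general (hA _ hφ) (hB _ hψ) hf (fun r => hk (φ r)) hv.symm
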